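/- Let $p$ be a prime, let $\mu\ge 1$ be an integer, and put $q=1/p$ and $s=\lfloor(\mu-1)/2\rfloor$. For integers $n\ge 0$ and $m\ge 1$, let $P(n,m)$ be the probability that a random symmetric $n\times n$ matrix $A$ over $\mathbb{Z}/m\mathbb{Z}$ (the entries on and above the diagonal being independent and uniformly distributed) has $m$-rank $n$, where the $m$-rank of $A$ is the greatest integer $k$ such that $A$ has a $k\times k$ submatrix (not necessarily contiguous) whose determinant is nonzero modulo $m$, or $0$ if there is no such submatrix. Let $Q(n,m)=1-P(n,m)$. Let $\Pi_n(x)=\prod_{j=1}^{n}(1-x^j)$ and, for $0\le x<1$, $\Pi_\infty(x)=\prod_{j=1}^{\infty}(1-x^j)$. Then $\lim_{n\to\infty}Q(n,p^\mu)$ exists and lies in the interval $[q^\mu,\;q^\mu/(1-q)]$. Moreover, $$\lim_{n\to\infty}P(n,p^\mu)=\frac{\Pi_\infty(q)}{(1-q)\,\Pi_\infty(q^2)}\sum_{j=0}^{s}\frac{q^{3j}-q^{\mu+j}}{\Pi_j(q^2)}$$ and $$\lim_{n\to\infty}Q(n,p^\mu)=\frac{1}{1-q}\left(q^\mu-\frac{\Pi_\infty(q)}{\Pi_\infty(q^2)}\sum_{j=s+1}^{\infty}\frac{q^{\mu+j}-q^{3j}}{\Pi_j(q^2)}\right),$$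 where the infinite series converges. -/

import Mathlib

open Filter Topology

/-- The `m`-rank of a matrix with entries read modulo `m`: the greatest `k` such that some `k × k`
submatrix (not necessarily contiguous) has determinant nonzero modulo `m`, and `0` if there is
none.  The set below is bounded by `n`, because there is no embedding of `Fin k` into `Fin n`
for `k > n`; and `sSup ∅ = 0` in `ℕ`. -/
noncomputable def mRank {m n : ℕ} (A : Matrix (Fin n) (Fin n) (ZMod m)) : ℕ :=
  sSup {k : ℕ | ∃ r c : Fin k ↪o Fin n, (A.submatrix r c).det ≠ 0}

/-- `P(n, m)`, for `m ≥ 1`: the probability that a uniformly random symmetric `n × n` matrix over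
`ℤ / m` has `m`-rank `n`.  The uniform law on symmetric matrices is the law under which the entries
on and above the diagonal are independent and uniform. -/
noncomputable def symP (n m : ℕ) : ℝ :=
  (Nat.card {A : Matrix (Fin n) (Fin n) (ZMod m) // A.IsSymm ∧ mRank A = n} : ℝ) /
    (Nat.card {A : Matrix (Fin n) (Fin n) (ZMod m) // A.IsSymm} : ℝ)

/-- `Q(n, m) = 1 - P(n, m)`. -/
noncomputable def symQ (n m : ℕ) : ℝ := 1 - symP n m

/-- `Π_n(q) = ∏_{j = 1}^{n} (1 - q ^ j)`. -/
def qPi (n : ℕ) (q : ℝ) : ℝ := ∏ j ∈ Finset.Icc 1 n, (1 - q ^ j)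

/-- `Π_∞(q) = ∏_{j = 1}^{∞} (1 - q ^ j)`, used for `0 ≤ q < 1`. -/
noncomputable def qPiInf (q : ℝ) : ℝ := ∏' j : ℕ, (1 - q ^ (j + 1))

/-- The infinite product defining `Π_∞(q)` converges for `0 ≤ q < 1`. -/
theorem multipliable_qPi {q : ℝ} (h0 : 0 ≤ q) (h1 : q < 1) :
    Multipliable fun j : ℕ => 1 - q ^ (j + 1) := by
  have hs : Summable fun j : ℕ => ‖-q ^ (j + 1)‖ := by
    simpa [abs_of_nonneg h0, pow_succ] using (summable_geometric_of_lt_one h0 h1).mul_right q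
  simpa [sub_eq_add_neg] using multipliable_one_add_of_summable hs

/-- `Π_∞(q)` is the limit of `Π_n(q)` for `0 ≤ q < 1`. -/
theorem tendsto_qPi {q : ℝ} (h0 : 0 ≤ q) (h1 : q < 1) :
    Tendsto (fun n => qPi n q) atTop (𝓝 (qPiInf q)) := by
  have h := (multipliable_qPi h0 h1).hasProd.tendsto_prod_nat
  refine h.congr fun n => ?_
  rw [qPi, ← Finset.Ico_add_one_right_eq_Icc, Finset.prod_Ico_eq_prod_range]
  exact Finset.prod_congr (by simp) fun j _ => by rw [add_comm]

/-- `Π_∞(q) ≠ 0` for `0 ≤ q < 1`. -/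
theorem qPiInf_ne_zero {q : ℝ} (h0 : 0 ≤ q) (h1 : q < 1) : qPiInf q ≠ 0 := by
  have hs : Summable fun j : ℕ => ‖-q ^ (j + 1)‖ := by
    simpa [abs_of_nonneg h0, pow_succ] using (summable_geometric_of_lt_one h0 h1).mul_right q
  have := tprod_one_add_ne_zero_of_summable (f := fun j : ℕ => -q ^ (j + 1))
    (fun j => by
      have : q ^ (j + 1) < 1 := pow_lt_one₀ h0 h1 (by omega)
      simp only [ne_eq]; linarith) hs
  simpa [qPiInf, sub_eq_add_neg] using this

/-! Let G(n,k) be the probability that p^k does not divide the determinant of a random symmetric n×n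
matrix over ℤ/p^μ. The p^μ-rank is n exactly when the determinant is nonzero, so P(n,p^μ) = G(n,μ).

Eliminating the first row (a,b) of a matrix of size n+1 gives a recursion (`detAvg_succ`). A unit a
leaves a uniform symmetric matrix of size n. If p divides a but not all of b, there is an invertible
2×2 pivot, which leaves size n-1. If p divides the whole row, write a = p a': a unit a' releases one
factor p and leaves size n; otherwise p² comes out and size n+1 remains.

The recursion has an explicit solution (`eq_oddProb_of_recursion`). In size 2m+1 the valuation
behaves like X_0 + 2(X_1 + ... + X_m), truncated at μ, with independent geometric X_i of ratio
q^(2i+1); even sizes are combinations of odd ones. Letting m tend to infinity gives the formula for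
P. Euler's expansion of ∏ 1/(1 - z x^i) at x = q² then evaluates the complete series and turns 1 - P
into the formula for Q. Its tail is nonnegative, which is the upper bound; the event X_0 ≥ μ alone
accounts for the lower bound (`oddProb_le`). -/

/-! ### Symmetric matrices, borders and Schur complements. -/

/-- The symmetric matrices with rows and columns indexed by `ι`. -/
abbrev SymMat (ι R : Type*) := {A : Matrix ι ι R // A.IsSymm}

namespace SymMat

variable {ι κ R : Type*}

noncomputable instance [Finite ι] [Finite R] : Fintype (SymMat ι R) :=
  haveI : Finite (Matrix ι ι R) := inferInstanceAs (Finite (ι → ι → R))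
  Fintype.ofFinite _

/-- Renaming the indices of a symmetric matrix. -/
def reindex (e : ι ≃ κ) : SymMat ι R ≃ SymMat κ R where
  toFun A := ⟨A.1.submatrix e.symm e.symm, A.2.submatrix _⟩
  invFun A := ⟨A.1.submatrix e e, A.2.submatrix _⟩
  left_inv A := by ext; simp
  right_inv A := by ext; simp

/-- Translation by a symmetric matrix. -/
def shift [AddGroup R] (E : Matrix ι ι R) (hE : E.IsSymm) : SymMat ι R ≃ SymMat ι R where
  toFun A := ⟨A.1 - E, A.2.sub hE⟩
  invFun A := ⟨A.1 + E, A.2.add hE⟩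
  left_inv A := by ext; simp
  right_inv A := by ext; simp

/-- The symmetric matrix with first row `(a, b)` and remaining block `B`. -/
def border (a : R) (b : ι → R) (B : Matrix ι ι R) : Matrix (Unit ⊕ ι) (Unit ⊕ ι) R :=
  Matrix.fromBlocks (Matrix.of fun _ _ => a) (Matrix.replicateRow Unit b)
    (Matrix.replicateCol Unit b) B

theorem border_isSymm (a : R) (b : ι → R) {B : Matrix ι ι R} (hB : B.IsSymm) :
    (border a b B).IsSymm := by
  refine Matrix.IsSymm.fromBlocks ?_ ?_ hB <;> (ext; rfl)

/-- A symmetric matrix is its first row together with the remaining symmetric block. -/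
def borderEquiv : R × (ι → R) × SymMat ι R ≃ SymMat (Unit ⊕ ι) R where
  toFun x := ⟨border x.1 x.2.1 x.2.2.1, border_isSymm _ _ x.2.2.2⟩
  invFun A := (A.1 (.inl ()) (.inl ()), fun j => A.1 (.inl ()) (.inr j),
    ⟨A.1.submatrix .inr .inr, A.2.submatrix _⟩)
  left_inv x := by
    refine Prod.ext rfl (Prod.ext rfl (Subtype.ext ?_))
    ext; rfl
  right_inv A := by
    ext i j
    rcases i with i | i <;> rcases j with j | j
    · rfl
    · rfl
    · exact A.2.apply _ _
    · rfl

section Sums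

variable [Fintype ι] [DecidableEq ι] [Fintype κ] [DecidableEq κ] [CommRing R] [Fintype R]

/-- The sum of `w (det A)` over all symmetric matrices `A`. -/
noncomputable def detSum (ι : Type*) [Fintype ι] [DecidableEq ι] (w : R → ℝ) : ℝ :=
  ∑ A : SymMat ι R, w A.1.det

theorem detSum_congr (e : ι ≃ κ) (w : R → ℝ) : detSum ι w = detSum κ w :=
  Fintype.sum_equiv (reindex e) _ _ fun A => by simp [reindex]

omit [CommRing R] in
theorem sum_unit_sum (φ : Matrix (Unit ⊕ ι) (Unit ⊕ ι) R → ℝ) :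
    ∑ A : SymMat (Unit ⊕ ι) R, φ A.1 =
      ∑ a : R, ∑ b : ι → R, ∑ B : SymMat ι R, φ (border a b B.1) := by
  classical
  rw [← Fintype.sum_equiv borderEquiv (fun x => φ (border x.1 x.2.1 x.2.2.1)) _ fun x => rfl,
    Fintype.sum_prod_type]
  simp_rw [Fintype.sum_prod_type]

theorem detSum_unit_sum (w : R → ℝ) :
    detSum (Unit ⊕ ι) w =
      ∑ a : R, ∑ b : ι → R, ∑ B : SymMat ι R, w (border a b B.1).det :=
  sum_unit_sum fun A => w A.det

omit [CommRing R] in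
theorem card_unit_sum : Fintype.card (SymMat (Unit ⊕ ι) R) =
    Fintype.card R * (Fintype.card R ^ Fintype.card ι * Fintype.card (SymMat ι R)) := by
  classical
  rw [← Fintype.card_congr (borderEquiv (ι := ι) (R := R))]
  simp [Fintype.card_prod]

theorem sum_det_sub (w : R → ℝ) {E : Matrix ι ι R} (hE : E.IsSymm) :
    ∑ B : SymMat ι R, w (B.1 - E).det = detSum ι w :=
  Fintype.sum_equiv (shift E hE) _ _ fun _ => rfl

variable {w : R → ℝ}

/-- The Schur complement of X is D minus a fixed symmetric matrix, and such a translation permutes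
the symmetric matrices. The factor det X is invisible to `w`, which by `hw` sees its argument only
up to units. -/
theorem sum_det_fromBlocks (hw : ∀ u x, IsUnit u → w (u * x) = w x) {X : Matrix ι ι R}
    (hX : X.IsSymm) (hu : IsUnit X.det) (Y : Matrix ι κ R) :
    ∑ D : SymMat κ R, w (Matrix.fromBlocks X Y Y.transpose D.1).det = detSum κ w := by
  have : Invertible X := Matrix.invertibleOfIsUnitDet X hu
  simp_rw [Matrix.det_fromBlocks₁₁, hw _ _ hu]
  refine sum_det_sub w ?_
  rw [Matrix.IsSymm, Matrix.transpose_mul, Matrix.transpose_mul, Matrix.transpose_transpose,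
    Matrix.invOf_eq_nonsing_inv, Matrix.transpose_nonsing_inv, hX, Matrix.mul_assoc]

theorem sum_det_border_of_isUnit (hw : ∀ u x, IsUnit u → w (u * x) = w x) {a : R}
    (ha : IsUnit a) (b : ι → R) :
    ∑ B : SymMat ι R, w (border a b B.1).det = detSum ι w :=
  sum_det_fromBlocks (X := Matrix.of fun _ _ => a) hw (by ext; rfl)
    (by simpa using ha) (Matrix.replicateRow Unit b)

theorem sum_det_border_border (hw : ∀ u x, IsUnit u → w (u * x) = w x) {a c : R}
    (b : Unit ⊕ κ → R) (d : κ → R) (hu : IsUnit (a * c - b (.inl ()) * b (.inl ()))) :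
    ∑ D : SymMat κ R, w (border a b (border c d D.1)).det = detSum κ w := by
  let X : Matrix (Unit ⊕ Unit) (Unit ⊕ Unit) R := border a (fun _ => b (.inl ())) (Matrix.of fun _ _ => c)
  let Y : Matrix (Unit ⊕ Unit) κ R := Matrix.of (Sum.elim (fun _ j => b (.inr j)) (fun _ => d))
  have hX : X.IsSymm := border_isSymm _ _ (by ext; rfl)
  have hdet : X.det = a * c - b (.inl ()) * b (.inl ()) := by
    rw [← Matrix.det_submatrix_equiv_self (finSumFinEquiv (m := 1) (n := 1) |>.symm.trans
      (Equiv.sumCongr (Equiv.ofUnique _ Unit) (Equiv.ofUnique _ Unit))) X]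
    erw [Matrix.det_fin_two]
    rfl
  rw [← sum_det_fromBlocks hw hX (hdet ▸ hu) Y]
  refine Finset.sum_congr rfl fun D _ => ?_
  rw [← Matrix.det_submatrix_equiv_self (Equiv.sumAssoc Unit Unit κ)]
  congr 2
  ext i j
  rcases i with (i | i) | i <;> rcases j with (j | j) | j <;> rfl

/-- The pivot is the 2×2 corner with entries a, b, b, c. It must be invertible for every c, because
c is summed over freely together with the rest of its row; these free entries give the powers of
|R|. -/
theorem sum_det_border_of_isUnit_inl (hw : ∀ u x, IsUnit u → w (u * x) = w x) {a : R}
    (b : Unit ⊕ κ → R) (hu : ∀ c, IsUnit (a * c - b (.inl ()) * b (.inl ()))) :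
    ∑ B : SymMat (Unit ⊕ κ) R, w (border a b B.1).det =
      Fintype.card R * (Fintype.card R ^ Fintype.card κ * detSum κ w) := by
  classical
  rw [sum_unit_sum fun B => w (border a b B).det]
  simp_rw [sum_det_border_border hw b _ (hu _)]
  simp

theorem sum_det_border_of_isUnit_apply (hw : ∀ u x, IsUnit u → w (u * x) = w x) {a : R}
    (b : ι → R) (j : ι) (hu : ∀ c, IsUnit (a * c - b j * b j)) {n : ℕ}
    (hn : Fintype.card ι = n + 1) :
    ∑ B : SymMat ι R, w (border a b B.1).det =
      Fintype.card R ^ (n + 1) * detSum (Fin n) w := by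
  have hc : Fintype.card {i // ¬ i = j} = n := by
    rw [Fintype.card_subtype_compl, Fintype.card_subtype_eq]; omega
  let e : Unit ⊕ Fin n ≃ ι := (Equiv.sumCongr (Equiv.ofUnique _ {i // i = j})
    (Fintype.equivFinOfCardEq hc).symm).trans (Equiv.sumCompl (· = j))
  have he : e (.inl ()) = j := rfl
  have := sum_det_border_of_isUnit_inl hw (b ∘ e) (a := a) (by simpa [he] using hu)
  rw [Fintype.card_fin, ← mul_assoc, ← pow_succ'] at this
  rw [← this]
  refine Fintype.sum_equiv (reindex e.symm) _ _ fun B => ?_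
  rw [← Matrix.det_submatrix_equiv_self (Equiv.sumCongr (Equiv.refl Unit) e)]
  congr 2
  ext i j
  rcases i with i | i <;> rcases j with j | j <;> rfl

omit [Fintype R] in
theorem det_border_mul_mul (π a : R) (b : ι → R) (B : Matrix ι ι R) :
    (border (π * (π * a)) (fun i => π * b i) B).det = π * π * (border a b B).det := by
  have h : border (π * (π * a)) (fun i => π * b i) B =
      Matrix.diagonal (Sum.elim (fun _ => π) fun _ => 1) * border a b B *
        Matrix.diagonal (Sum.elim (fun _ => π) fun _ => 1) := by
    ext i j
    rw [Matrix.mul_diagonal, Matrix.diagonal_mul]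
    rcases i with i | i <;> rcases j with j | j <;> simp [border] <;> ring
  rw [h, Matrix.det_mul, Matrix.det_mul, Matrix.det_diagonal]
  simp
  ring

/-- Only the first row is divided by π, so the column keeps its factor π. The Schur complement of a
then subtracts π a⁻¹ b bᵀ, which is still symmetric. -/
theorem sum_det_border_mul (hw : ∀ u x, IsUnit u → w (u * x) = w x) (π : R) {a : R}
    (ha : IsUnit a) (b : ι → R) :
    ∑ B : SymMat ι R, w (border (π * a) (fun i => π * b i) B.1).det =
      detSum ι fun x => w (π * x) := by
  let X : Matrix Unit Unit R := Matrix.of fun _ _ => a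
  have hX : IsUnit X.det := by simpa [X] using ha
  have : Invertible X := Matrix.invertibleOfIsUnitDet X hX
  let E : Matrix ι ι R := Matrix.replicateCol Unit (fun i => π * b i) * ⅟X * Matrix.replicateRow Unit b
  have hE : E.IsSymm := by
    ext i j
    simp [E, Matrix.mul_apply]
    ring
  have h (B : Matrix ι ι R) : (border (π * a) (fun i => π * b i) B).det =
      X.det * (π * (B - E).det) := by
    have h : border (π * a) (fun i => π * b i) B =
        Matrix.diagonal (Sum.elim (fun _ => π) fun _ => 1) *
          Matrix.fromBlocks X (Matrix.replicateRow Unit b)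
            (Matrix.replicateCol Unit fun i => π * b i) B := by
      ext i j
      rw [Matrix.diagonal_mul]
      rcases i with i | i <;> rcases j with j | j <;> simp [border, X]
    rw [h, Matrix.det_mul, Matrix.det_diagonal, Matrix.det_fromBlocks₁₁]
    simp [E]
    ring
  simp_rw [h, hw _ _ hX]
  exact sum_det_sub (fun x => w (π * x)) hE

end Sums

end SymMat

/-! ### Fibres of multiplication by π. -/

/-- Fibres of constant size over the image carry the uniform law to the uniform law. Hence a uniform
multiple of π may be written π x with x uniform. -/
theorem sum_comp_eq_mul_sum_filter {α β : Type*} [Fintype α] [Fintype β] [DecidableEq β]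
    {f : α → β} {P : β → Prop} [DecidablePred P] {c : ℕ}
    (h : ∀ y, (Finset.univ.filter fun x => f x = y).card = if P y then c else 0) (φ : β → ℝ) :
    ∑ x, φ (f x) = c * ∑ y with P y, φ y := by
  rw [← Finset.sum_fiberwise Finset.univ f, Finset.mul_sum, Finset.sum_filter]
  refine Finset.sum_congr rfl fun y _ => ?_
  rw [Finset.sum_congr rfl (g := fun _ => φ y) fun x hx => by rw [(Finset.mem_filter.1 hx).2],
    Finset.sum_const, h]
  split_ifs <;> simp

theorem card_mul_fiber {R : Type*} [CommRing R] [Fintype R] [DecidableEq R] (π : R)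
    [DecidablePred (π ∣ ·)] (y : R) :
    (Finset.univ.filter fun x => π * x = y).card =
      if π ∣ y then (Finset.univ.filter fun x => π * x = 0).card else 0 := by
  split_ifs with h
  · obtain ⟨z, rfl⟩ := h
    refine Finset.card_bij' (fun x _ => x - z) (fun x _ => x + z) ?_ ?_ ?_ ?_ <;>
      simp +contextual [mul_sub, mul_add]
  · refine Finset.card_eq_zero.2 (Finset.filter_eq_empty_iff.2 fun x _ hx => h ⟨x, hx.symm⟩)

theorem card_pi_mul_fiber {ι R : Type*} [Fintype ι] [DecidableEq ι] [CommRing R] [Fintype R]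
    [DecidableEq R] (π : R) (y : ι → R) [Decidable (∀ i, π ∣ y i)] :
    (Finset.univ.filter fun x : ι → R => (fun i => π * x i) = y).card =
      if ∀ i, π ∣ y i then (Finset.univ.filter fun x => π * x = 0).card ^ Fintype.card ι else 0 := by
  have h : (Finset.univ.filter fun x : ι → R => (fun i => π * x i) = y) =
      Fintype.piFinset fun i => Finset.univ.filter fun x => π * x = y i := by
    ext x
    simp [funext_iff]
  classical
  rw [h, Fintype.card_piFinset]
  rw [Finset.prod_congr rfl fun i _ => card_mul_fiber π (y i)]
  split_ifs with h
  · rw [Finset.prod_congr rfl fun i _ => if_pos (h i), Finset.prod_const, Finset.card_univ]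
  · push Not at h
    obtain ⟨i, hi⟩ := h
    exact Finset.prod_eq_zero (Finset.mem_univ i) (if_neg hi)

/-! ### The recursion over a finite local ring. -/

namespace SymMat

variable {R : Type*} [CommRing R] [Fintype R]

/-- The average of `w (det A)` over all symmetric `n × n` matrices `A`. -/
noncomputable def detAvg (n : ℕ) (w : R → ℝ) : ℝ :=
  detSum (Fin n) w / Fintype.card (SymMat (Fin n) R)

theorem detAvg_zero (w : R → ℝ) : detAvg 0 w = w 1 := by
  have : Unique (SymMat (Fin 0) R) := ⟨⟨⟨0, by ext i; exact i.elim0⟩⟩, fun A => by ext i; exact i.elim0⟩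
  simp [detAvg, detSum]

theorem card_fin_succ (n : ℕ) : Fintype.card (SymMat (Fin (n + 1)) R) =
    Fintype.card R * (Fintype.card R ^ n * Fintype.card (SymMat (Fin n) R)) := by
  rw [Fintype.card_congr (reindex ((Fintype.equivFinOfCardEq (α := Unit ⊕ Fin n)
    (by simp [add_comm])).symm)), card_unit_sum, Fintype.card_fin]

theorem detSum_fin_succ (n : ℕ) (w : R → ℝ) : detSum (Fin (n + 1)) w =
    ∑ a : R, ∑ b : Fin n → R, ∑ B : SymMat (Fin n) R, w (border a b B.1).det := by
  rw [detSum_congr (Fintype.equivFinOfCardEq (α := Unit ⊕ Fin n) (by simp [add_comm])).symm,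
    detSum_unit_sum]

theorem card_pos (n : ℕ) : (0 : ℝ) < Fintype.card (SymMat (Fin n) R) := by
  have : Nonempty (SymMat (Fin n) R) := ⟨⟨0, Matrix.isSymm_zero⟩⟩
  exact_mod_cast Fintype.card_pos

variable [DecidableEq R] {π : R} {w : R → ℝ}

/-- The recursion obtained by eliminating the first row of a random symmetric matrix over a finite
local ring with principal maximal ideal `π R`. -/
theorem detAvg_succ (hπ : ∀ x : R, IsUnit x ↔ ¬ π ∣ x)
    (hw : ∀ u x, IsUnit u → w (u * x) = w x) {q : ℝ}
    (hq : q = 1 / ((Finset.univ.filter fun x => π * x = 0).card : ℝ)) (n : ℕ) :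
    detAvg (n + 1) w = (1 - q) * detAvg n w + q * (1 - q ^ n) * detAvg (n - 1) w +
      q ^ (n + 1) * ((1 - q) * detAvg n (fun x => w (π * x)) +
        q * detAvg (n + 1) fun x => w (π * π * x)) := by
  classical
  set c : ℕ := (Finset.univ.filter fun x => π * x = 0).card with hc
  set r : ℝ := (Fintype.card R : ℝ) with hr
  have hc0 : (0 : ℝ) < c := by
    exact_mod_cast Finset.card_pos.2 ⟨0, by simp⟩
  have hr0 : 0 < r := by
    rw [hr]
    exact_mod_cast Fintype.card_pos
  have hq0 : q ≠ 0 := by rw [hq]; positivity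
  have hcq : (c : ℝ) = q⁻¹ := by rw [hq]; simp
  have scalar (φ : R → ℝ) : ∑ a with π ∣ a, φ a = q * ∑ a, φ (π * a) := by
    rw [sum_comp_eq_mul_sum_filter (card_mul_fiber π) φ, ← hc, hcq, mul_inv_cancel_left₀ hq0]
  have vector (φ : (Fin n → R) → ℝ) :
      ∑ b ∈ Finset.univ.filter fun b : Fin n → R => ∀ i, π ∣ b i, φ b =
        q ^ n * ∑ b : Fin n → R, φ fun i => π * b i := by
    rw [sum_comp_eq_mul_sum_filter (P := fun b : Fin n → R => ∀ i, π ∣ b i)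
      (fun b => card_pi_mul_fiber π b) φ, ← hc, Fintype.card_fin, Nat.cast_pow,
      hcq, inv_pow, mul_inv_cancel_left₀ (pow_ne_zero n hq0)]
  have card_dvd : ((Finset.univ.filter fun a : R => π ∣ a).card : ℝ) = q * r := by
    simpa using scalar fun _ => 1
  have card_unit : ((Finset.univ.filter fun a : R => ¬ π ∣ a).card : ℝ) = (1 - q) * r := by
    have := Finset.card_filter_add_card_filter_not (s := (Finset.univ : Finset R)) (π ∣ ·)
    have : ((Finset.univ.filter fun a : R => π ∣ a).card : ℝ) +
      (Finset.univ.filter fun a : R => ¬ π ∣ a).card = r := by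
      rw [hr]
      exact_mod_cast this
    linarith
  have card_vec : ((Finset.univ.filter fun b : Fin n → R => ¬ ∀ i, π ∣ b i).card : ℝ) =
      (1 - q ^ n) * r ^ n := by
    have h1 : ((Finset.univ.filter fun b : Fin n → R => ∀ i, π ∣ b i).card : ℝ) = q ^ n * r ^ n := by
      simpa using vector fun _ => 1
    have := Finset.card_filter_add_card_filter_not (s := (Finset.univ : Finset (Fin n → R)))
      (fun b => ∀ i, π ∣ b i)
    have : ((Finset.univ.filter fun b : Fin n → R => ∀ i, π ∣ b i).card : ℝ) +
      (Finset.univ.filter fun b : Fin n → R => ¬ ∀ i, π ∣ b i).card = r ^ n := by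
      have h2 : Fintype.card (Fin n → R) = Fintype.card R ^ n := by simp
      rw [hr]
      exact_mod_cast this.trans h2
    linarith
  have split (φ : R → ℝ) : ∑ a, φ a = ∑ a with ¬ π ∣ a, φ a + q * ∑ a, φ (π * a) := by
    rw [← scalar, add_comm, Finset.sum_filter_add_sum_filter_not]
  have unit_part (v : R → ℝ) (hv : ∀ u x, IsUnit u → v (u * x) = v x) :
      ∑ a with ¬ π ∣ a, ∑ b : Fin n → R, ∑ B : SymMat (Fin n) R, v (border a b B.1).det =
        (1 - q) * r * (r ^ n * detSum (Fin n) v) := by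
    rw [Finset.sum_congr rfl (g := fun _ => r ^ n * detSum (Fin n) v), Finset.sum_const,
      nsmul_eq_mul, card_unit]
    intro a ha
    rw [Finset.sum_congr rfl fun b _ =>
      sum_det_border_of_isUnit hv ((hπ a).2 (Finset.mem_filter.1 ha).2) b]
    simp [hr]
  have block_part (a : R) (ha : π ∣ a) :
      ∑ b ∈ Finset.univ.filter fun b : Fin n → R => ¬ ∀ i, π ∣ b i, ∑ B : SymMat (Fin n) R, w (border a b B.1).det =
        (1 - q ^ n) * r ^ n * (r ^ n * detSum (Fin (n - 1)) w) := by
    rw [Finset.sum_congr rfl (g := fun _ => r ^ n * detSum (Fin (n - 1)) w), Finset.sum_const,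
      nsmul_eq_mul, card_vec]
    intro b hb
    have hb := (Finset.mem_filter.1 hb).2
    push Not at hb
    obtain ⟨j, hj⟩ := hb
    have hn : n = n - 1 + 1 := by have := j.2; omega
    rw [sum_det_border_of_isUnit_apply hw b j _ (n := n - 1) (by simpa using hn), ← hn]
    intro c
    -- As π divides a, the term a c does not affect divisibility by π, and b_j² is a unit.
    rw [hπ, dvd_sub_right (ha.mul_right c), ← hπ]
    exact ((hπ _).2 hj).mul ((hπ _).2 hj)
  have div_part : ∑ a : R, ∑ b : Fin n → R, ∑ B : SymMat (Fin n) R,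
      w (border (π * a) (fun i => π * b i) B.1).det =
        (1 - q) * r * (r ^ n * detSum (Fin n) fun x => w (π * x)) +
          q * detSum (Fin (n + 1)) fun x => w (π * π * x) := by
    rw [split, detSum_fin_succ]
    simp_rw [det_border_mul_mul]
    congr 1
    rw [Finset.sum_congr rfl (g := fun _ => r ^ n * detSum (Fin n) fun x => w (π * x)),
      Finset.sum_const, nsmul_eq_mul, card_unit]
    intro a ha
    rw [Finset.sum_congr rfl fun b _ =>
      sum_det_border_mul hw π ((hπ a).2 (Finset.mem_filter.1 ha).2) b]
    simp [hr]
  have main : detSum (Fin (n + 1)) w = (1 - q) * r * (r ^ n * detSum (Fin n) w) +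
      q * r * ((1 - q ^ n) * r ^ n * (r ^ n * detSum (Fin (n - 1)) w)) +
      q ^ (n + 1) * ((1 - q) * r * (r ^ n * detSum (Fin n) fun x => w (π * x)) +
          q * detSum (Fin (n + 1)) fun x => w (π * π * x)) := by
    rw [← div_part, detSum_fin_succ, split, unit_part w hw, add_assoc]
    congr 1
    rw [Finset.sum_congr rfl (g := fun a => q ^ n * ∑ b : Fin n → R, ∑ B : SymMat (Fin n) R,
      w (border (π * a) (fun i => π * b i) B.1).det +
        (1 - q ^ n) * r ^ n * (r ^ n * detSum (Fin (n - 1)) w))]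
    · rw [Finset.sum_add_distrib, ← Finset.mul_sum]
      simp only [Finset.sum_const, Finset.card_univ, nsmul_eq_mul, ← hr]
      ring
    · intro a _
      rw [← block_part (π * a) (dvd_mul_right _ _),
        ← vector fun b => ∑ B : SymMat (Fin n) R, w (border (π * a) b B.1).det,
        Finset.sum_filter_add_sum_filter_not]
  have hs := card_pos (R := R) n
  have hcard : (Fintype.card (SymMat (Fin (n + 1)) R) : ℝ) =
      r * (r ^ n * Fintype.card (SymMat (Fin n) R)) := by
    rw [hr]
    exact_mod_cast card_fin_succ n
  -- For n = 0 the truncated size n - 1 is meaningless, but its coefficient 1 - q^0 vanishes.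
  have hblock : (1 - q ^ n) * detAvg (n - 1) w = (1 - q ^ n) *
      (r ^ n * detSum (Fin (n - 1)) w / Fintype.card (SymMat (Fin n) R)) := by
    rcases n with _ | n
    · simp
    · have hs' := card_pos (R := R) n
      have : (Fintype.card (SymMat (Fin (n + 1)) R) : ℝ) =
        r * (r ^ n * Fintype.card (SymMat (Fin n) R)) := by
        rw [hr]
        exact_mod_cast card_fin_succ n
      rw [this, Nat.add_sub_cancel, detAvg]
      field_simp
      ring
  rw [mul_assoc q, hblock]
  simp only [detAvg]
  rw [hcard]
  rw [main]
  field_simp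

end SymMat

/-! ### The m-rank and the recursion over ℤ/p^M. -/

theorem mRank_eq_iff {m n : ℕ} [Nontrivial (ZMod m)] (A : Matrix (Fin n) (Fin n) (ZMod m)) :
    mRank A = n ↔ A.det ≠ 0 := by
  have hle : ∀ k ∈ {k : ℕ | ∃ r c : Fin k ↪o Fin n, (A.submatrix r c).det ≠ 0}, k ≤ n := by
    rintro k ⟨r, -⟩
    simpa using Fintype.card_le_of_embedding r.toEmbedding
  have hmem : n ∈ {k : ℕ | ∃ r c : Fin k ↪o Fin n, (A.submatrix r c).det ≠ 0} ↔ A.det ≠ 0 := by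
    constructor
    · rintro ⟨r, c, h⟩
      -- The only order embedding of `Fin n` into itself is the identity, so the only n×n submatrix
      -- is A.
      have id_of (f : Fin n ↪o Fin n) : (f : Fin n → Fin n) = id := by
        refine (StrictMono.range_inj f.strictMono strictMono_id).1 ?_
        rw [(Finite.injective_iff_surjective.1 f.injective).range_eq, Set.range_id]
      simpa [id_of] using h
    · exact fun h => ⟨RelEmbedding.refl _, RelEmbedding.refl _, by simpa using h⟩
  have h0 : 0 ∈ {k : ℕ | ∃ r c : Fin k ↪o Fin n, (A.submatrix r c).det ≠ 0} :=
    ⟨(Fin.castLEOrderEmb n.zero_le), (Fin.castLEOrderEmb n.zero_le), by simp⟩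
  rw [← hmem]
  refine ⟨fun h => ?_, fun h => le_antisymm (csSup_le ⟨0, h0⟩ hle) (le_csSup ⟨n, hle⟩ h)⟩
  have := Nat.sSup_mem ⟨0, h0⟩ ⟨n, hle⟩
  rwa [← mRank, h] at this

namespace SymMat

variable {p M : ℕ}

/-- For k ≤ M, reduction modulo p^k is defined on ℤ/p^M, so divisibility by p^k can be tested on
integer representatives. -/
theorem natCast_pow_dvd_iff {k : ℕ} (hk : k ≤ M) (n : ℕ) :
    (p : ZMod (p ^ M)) ^ k ∣ (n : ZMod (p ^ M)) ↔ p ^ k ∣ n := by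
  constructor
  · rintro ⟨y, hy⟩
    have := congrArg (ZMod.castHom (pow_dvd_pow p hk) (ZMod (p ^ k))) hy
    rw [map_mul, map_pow, map_natCast, map_natCast, ← Nat.cast_pow, ZMod.natCast_self, zero_mul]
      at this
    exact (ZMod.natCast_eq_zero_iff _ _).1 this
  · rintro ⟨y, rfl⟩
    exact ⟨y, by push_cast; rfl⟩

theorem isUnit_iff_not_dvd (hp : p.Prime) (hM : 1 ≤ M) (x : ZMod (p ^ M)) :
    IsUnit x ↔ ¬ (p : ZMod (p ^ M)) ∣ x := by
  have : NeZero (p ^ M) := ⟨pow_ne_zero M hp.ne_zero⟩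
  rw [← ZMod.natCast_zmod_val x, ZMod.isUnit_iff_coprime, ← pow_one (p : ZMod (p ^ M)),
    natCast_pow_dvd_iff hM, pow_one, Nat.coprime_pow_right_iff (by omega), Nat.coprime_comm,
    hp.coprime_iff_not_dvd]

theorem pow_dvd_mul_iff (hp : p.Prime) {k : ℕ} (hk : k ≤ M) (x : ZMod (p ^ M)) :
    (p : ZMod (p ^ M)) ^ k ∣ p * x ↔ (p : ZMod (p ^ M)) ^ (k - 1) ∣ x := by
  have : NeZero (p ^ M) := ⟨pow_ne_zero M hp.ne_zero⟩
  rcases k with _ | k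
  · simp
  · rw [← ZMod.natCast_zmod_val x, ← Nat.cast_mul, natCast_pow_dvd_iff hk, Nat.add_sub_cancel,
      natCast_pow_dvd_iff (by omega), pow_succ', Nat.mul_dvd_mul_iff_left hp.pos]

theorem card_mul_eq_zero (hp : p.Prime) (hM : 1 ≤ M) [Fintype (ZMod (p ^ M))]
    [DecidableEq (ZMod (p ^ M))] :
    (Finset.univ.filter fun x : ZMod (p ^ M) => (p : ZMod (p ^ M)) * x = 0).card = p := by
  classical
  have : NeZero (p ^ M) := ⟨pow_ne_zero M hp.ne_zero⟩
  obtain ⟨M, rfl⟩ : ∃ N, M = N + 1 := ⟨M - 1, by omega⟩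
  -- This says that |R| is the size of the kernel times the number of multiples of p; the latter is
  -- found by removing the units, counted by the totient.
  have h1 := sum_comp_eq_mul_sum_filter (card_mul_fiber (p : ZMod (p ^ (M + 1)))) fun _ => (1 : ℝ)
  have hu : (Finset.univ.filter fun x : ZMod (p ^ (M + 1)) => ¬ (p : ZMod (p ^ (M + 1))) ∣ x).card =
      p ^ M * (p - 1) := by
    rw [← Nat.totient_prime_pow_succ hp, ← ZMod.card_units_eq_totient,
      ← Finset.card_univ, ← Finset.card_map ⟨Units.val, Units.val_injective⟩]
    congr 1
    ext x
    rw [Finset.mem_filter, ← isUnit_iff_not_dvd hp hM]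
    simp [IsUnit]
  have h2 := Finset.card_filter_add_card_filter_not (s := (Finset.univ : Finset (ZMod (p ^ (M + 1)))))
    ((p : ZMod (p ^ (M + 1))) ∣ ·)
  rw [hu, Finset.card_univ, Fintype.card_eq_nat_card, Nat.card_zmod] at h2
  simp only [Finset.sum_const, nsmul_eq_mul, mul_one, Finset.card_univ, Fintype.card_eq_nat_card,
    Nat.card_zmod] at h1
  norm_cast at h1
  obtain ⟨r, rfl⟩ : ∃ r, p = r + 1 := ⟨p - 1, by have := hp.pos; omega⟩
  have h3 : (Finset.univ.filter fun x : ZMod ((r + 1) ^ (M + 1)) =>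
    ((r + 1 : ℕ) : ZMod ((r + 1) ^ (M + 1))) ∣ x).card = (r + 1) ^ M := by
    rw [Nat.add_sub_cancel] at h2
    exact Nat.add_right_cancel (h2.trans (by ring : _ = (r + 1) ^ M + (r + 1) ^ M * r))
  rw [h3] at h1
  exact Nat.eq_of_mul_eq_mul_right (by positivity) (h1.symm.trans (pow_succ' _ _))

open Classical in
/-- The indicator function of the residues modulo `p ^ M` that are not divisible by `p ^ k`. -/
noncomputable def notDvd (p M k : ℕ) (x : ZMod (p ^ M)) : ℝ :=
  if (p : ZMod (p ^ M)) ^ k ∣ x then 0 else 1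

theorem notDvd_congr {k l : ℕ} {x y : ZMod (p ^ M)}
    (h : (p : ZMod (p ^ M)) ^ k ∣ x ↔ (p : ZMod (p ^ M)) ^ l ∣ y) :
    notDvd p M k x = notDvd p M l y := by
  by_cases hx : (p : ZMod (p ^ M)) ^ k ∣ x
  · simp [notDvd, hx, h.1 hx]
  · simp [notDvd, hx, mt h.2 hx]

/-- The probability that the determinant of a random symmetric `n × n` matrix over `ℤ / p ^ M`
is not divisible by `p ^ k`. -/
noncomputable def probNotDvd (p M : ℕ) [NeZero (p ^ M)] (n k : ℕ) : ℝ :=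
  detAvg n (notDvd p M k)

section

variable [NeZero (p ^ M)]

theorem probNotDvd_zero_right (n : ℕ) : probNotDvd p M n 0 = 0 := by
  simp [probNotDvd, detAvg, detSum, notDvd]

theorem probNotDvd_zero_left (hp : p.Prime) {k : ℕ} (hk : 1 ≤ k) (hkM : k ≤ M) :
    probNotDvd p M 0 k = 1 := by
  rw [probNotDvd, detAvg_zero, notDvd, if_neg]
  rw [← Nat.cast_one, natCast_pow_dvd_iff hkM, Nat.dvd_one]
  exact (Nat.one_lt_pow (by omega) hp.one_lt).ne'

theorem probNotDvd_succ (hp : p.Prime) (hM : 1 ≤ M) {q : ℝ} (hq : q = 1 / p) (n : ℕ) {k : ℕ}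
    (hk : k ≤ M) :
    probNotDvd p M (n + 1) k = (1 - q) * probNotDvd p M n k +
      q * (1 - q ^ n) * probNotDvd p M (n - 1) k +
      q ^ (n + 1) * ((1 - q) * probNotDvd p M n (k - 1) + q * probNotDvd p M (n + 1) (k - 2)) := by
  have h1 : (fun x => notDvd p M k (p * x)) = notDvd p M (k - 1) :=
    funext fun x => notDvd_congr (pow_dvd_mul_iff hp hk x)
  have h2 : (fun x => notDvd p M k (p * p * x)) = notDvd p M (k - 2) :=
    funext fun x => notDvd_congr (by
      rw [mul_assoc, pow_dvd_mul_iff hp hk, pow_dvd_mul_iff hp (by omega), Nat.sub_sub])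
  rw [probNotDvd, detAvg_succ (isUnit_iff_not_dvd hp hM) _
    (hq.trans (by rw [card_mul_eq_zero hp hM])), h1, h2]
  · rfl
  · exact fun u x hu => notDvd_congr hu.dvd_mul_left

theorem symP_eq_probNotDvd (hp : p.Prime) (hM : 1 ≤ M) (n : ℕ) :
    symP n (p ^ M) = probNotDvd p M n M := by
  classical
  have : Fact (1 < p ^ M) := ⟨Nat.one_lt_pow (by omega) hp.one_lt⟩
  have hzero : (p : ZMod (p ^ M)) ^ M = 0 := by
    rw [← Nat.cast_pow, ZMod.natCast_self]
  rw [symP, probNotDvd, detAvg, ← Nat.card_eq_fintype_card]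
  congr 1
  simp only [detSum, notDvd, hzero, zero_dvd_iff, mRank_eq_iff]
  rw [Nat.card_congr (Equiv.subtypeSubtypeEquivSubtypeInter _ _).symm, Nat.card_eq_fintype_card,
    Fintype.card_subtype, Finset.card_filter]
  push_cast
  refine Finset.sum_congr rfl fun A _ => ?_
  by_cases h : A.1.det = 0 <;> simp [h]

end

end SymMat

theorem tendsto_atTop_of_even_odd {α : Type*} {u : ℕ → α} {l : Filter α}
    (he : Tendsto (fun m => u (2 * m)) atTop l) (ho : Tendsto (fun m => u (2 * m + 1)) atTop l) :
    Tendsto u atTop l := by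
  intro U hU
  obtain ⟨a, ha⟩ := mem_atTop_sets.1 (he hU)
  obtain ⟨b, hb⟩ := mem_atTop_sets.1 (ho hU)
  refine mem_atTop_sets.2 ⟨2 * (a + b), fun n hn => ?_⟩
  rcases Nat.even_or_odd' n with ⟨m, rfl | rfl⟩
  · exact ha m (by omega)
  · exact hb m (by omega)

/-! ### The products Π_n and Euler's expansion. -/

section QPi

variable {x : ℝ}

theorem qPi_zero (x : ℝ) : qPi 0 x = 1 := by simp [qPi]

theorem qPi_succ (n : ℕ) (x : ℝ) : qPi (n + 1) x = qPi n x * (1 - x ^ (n + 1)) := by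
  rw [qPi, qPi, Finset.prod_Icc_succ_top (by omega)]

theorem one_sub_pow_pos (h0 : 0 ≤ x) (h1 : x < 1) {n : ℕ} (hn : n ≠ 0) : 0 < 1 - x ^ n :=
  sub_pos.2 (pow_lt_one₀ h0 h1 hn)

theorem one_sub_pow_nonneg (h0 : 0 ≤ x) (h1 : x < 1) (n : ℕ) : 0 ≤ 1 - x ^ n :=
  sub_nonneg.2 (pow_le_one₀ h0 h1.le)

theorem qPi_pos (h0 : 0 ≤ x) (h1 : x < 1) (n : ℕ) : 0 < qPi n x :=
  Finset.prod_pos fun j hj => one_sub_pow_pos h0 h1 (by have := (Finset.mem_Icc.1 hj).1; omega)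

theorem qPiInf_le_qPi (h0 : 0 ≤ x) (h1 : x < 1) (n : ℕ) : qPiInf x ≤ qPi n x := by
  refine Antitone.le_of_tendsto (antitone_nat_of_succ_le fun n => ?_) (tendsto_qPi h0 h1) n
  rw [qPi_succ]
  exact mul_le_of_le_one_right (qPi_pos h0 h1 n).le (by have := pow_nonneg h0 (n + 1); linarith)

theorem qPiInf_pos (h0 : 0 ≤ x) (h1 : x < 1) : 0 < qPiInf x :=
  lt_of_le_of_ne (ge_of_tendsto' (tendsto_qPi h0 h1) fun n => (qPi_pos h0 h1 n).le)
    (qPiInf_ne_zero h0 h1).symm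

theorem summable_pow_div_qPi (h0 : 0 ≤ x) (h1 : x < 1) {z : ℝ} (hz0 : 0 ≤ z) (hz1 : z < 1) :
    Summable fun j : ℕ => z ^ j / qPi j x := by
  refine Summable.of_nonneg_of_le (fun j => div_nonneg (pow_nonneg hz0 j) (qPi_pos h0 h1 j).le)
    (fun j => ?_) ((summable_geometric_of_lt_one hz0 hz1).div_const (qPiInf x))
  exact div_le_div_of_nonneg_left (pow_nonneg hz0 j) (qPiInf_pos h0 h1) (qPiInf_le_qPi h0 h1 j)

/-- With F(z) = ∑ z^j / Π_j(x), this is F(xz) = (1 - z) F(z). It follows termwise from (1 - x^j) /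
Π_j(x) = 1 / Π_{j-1}(x). -/
theorem one_sub_mul_tsum_pow_div_qPi (h0 : 0 ≤ x) (h1 : x < 1) {z : ℝ} (hz0 : 0 ≤ z)
    (hz1 : z < 1) :
    (1 - z) * ∑' j : ℕ, z ^ j / qPi j x = ∑' j : ℕ, (x * z) ^ j / qPi j x := by
  have hxz : x * z < 1 := by nlinarith
  have hs := summable_pow_div_qPi h0 h1 hz0 hz1
  have hs' := summable_pow_div_qPi h0 h1 (mul_nonneg h0 hz0) hxz
  have h : ∑' j : ℕ, (z ^ j / qPi j x - (x * z) ^ j / qPi j x) = z * ∑' j : ℕ, z ^ j / qPi j x := by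
    rw [(hs.sub hs').tsum_eq_zero_add, ← tsum_mul_left]
    simp only [pow_zero, sub_self, zero_add]
    refine tsum_congr fun j => ?_
    have := (qPi_pos h0 h1 j).ne'
    have := (one_sub_pow_pos h0 h1 j.succ_ne_zero).ne'
    rw [qPi_succ, ← sub_div, mul_pow]
    field_simp
    ring
  rw [hs.tsum_sub hs'] at h
  linarith

/-- Euler's expansion of `∏ 1 / (1 - z x ^ i)`. -/
theorem tendsto_prod_mul_tsum_pow_div_qPi (h0 : 0 ≤ x) (h1 : x < 1) {z : ℝ} (hz0 : 0 ≤ z)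
    (hz1 : z < 1) :
    Tendsto (fun n => (∏ i ∈ Finset.range n, (1 - z * x ^ i)) * ∑' j : ℕ, z ^ j / qPi j x)
      atTop (𝓝 1) := by
  have hle (n : ℕ) : x ^ n * z ≤ z := mul_le_of_le_one_left hz0 (pow_le_one₀ h0 h1.le)
  have hnn (n : ℕ) : 0 ≤ x ^ n * z := mul_nonneg (pow_nonneg h0 n) hz0
  have h (n : ℕ) : (∏ i ∈ Finset.range n, (1 - z * x ^ i)) * ∑' j : ℕ, z ^ j / qPi j x =
      ∑' j : ℕ, (x ^ n * z) ^ j / qPi j x := by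
    induction n with
    | zero => simp
    | succ n ih =>
      rw [Finset.prod_range_succ, mul_right_comm, ih, mul_comm, mul_comm z,
        one_sub_mul_tsum_pow_div_qPi h0 h1 (hnn n) ((hle n).trans_lt hz1), pow_succ', mul_assoc]
  simp_rw [h]
  -- After n uses of the functional equation the left side is F(x^n z), which tends to F(0) = 1; the
  -- series at z dominates.
  have hone : ∑' j : ℕ, (0 : ℝ) ^ j / qPi j x = 1 := by
    rw [tsum_eq_single 0 fun j hj => by simp [hj]]
    simp [qPi_zero]
  rw [← hone]
  refine tendsto_tsum_of_dominated_convergence (summable_pow_div_qPi h0 h1 hz0 hz1)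
    (fun j => ?_) (Eventually.of_forall fun n j => ?_)
  · refine Tendsto.div_const (Tendsto.pow ?_ j) _
    simpa using (tendsto_pow_atTop_nhds_zero_of_lt_one h0 h1).mul_const z
  · rw [Real.norm_of_nonneg (div_nonneg (pow_nonneg (hnn n) j) (qPi_pos h0 h1 j).le)]
    exact div_le_div_of_nonneg_right (pow_le_pow_left₀ (hnn n) (hle n) j) (qPi_pos h0 h1 j).le

end QPi

/-! ### The explicit solution of the recursion. -/

section ClosedForm

variable {q : ℝ}

/-- The product of `1 - q ^ i` over the odd `i` with `3 ≤ i ≤ 2 m + 1`. -/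
def oddProd (q : ℝ) (m : ℕ) : ℝ := ∏ i ∈ Finset.range m, (1 - q ^ (2 * i + 3))

/-- The coefficient of `t ^ (2 j)` in `∏ 1 / (1 - q ^ i t ^ 2)` over the odd `i` with
`3 ≤ i ≤ 2 m + 1`. -/
noncomputable def oddCoeff (q : ℝ) (m j : ℕ) : ℝ :=
  q ^ (3 * j) * (∏ i ∈ Finset.range j, (1 - (q ^ 2) ^ (m + i))) / qPi j (q ^ 2)

/-- For `k ≤ 2 N` and `q = 1 / p`, the probability that `p ^ k` does not divide the determinant of
a random symmetric matrix of size `2 m + 1`. -/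
noncomputable def oddProb (q : ℝ) (N m k : ℕ) : ℝ :=
  -- Truncated subtraction makes the factor 1 - q^0 = 0 once 2j ≥ k, so every N with k ≤ 2N gives
  -- the same value.
  oddProd q m * ∑ j ∈ Finset.range N, oddCoeff q m j * (1 - q ^ (k - 2 * j))

theorem sq_lt_one_of_lt_one (h0 : 0 ≤ q) (h1 : q < 1) : q ^ 2 < 1 := pow_lt_one₀ h0 h1 two_ne_zero

theorem oddProd_pos (h0 : 0 ≤ q) (h1 : q < 1) (m : ℕ) : 0 < oddProd q m :=
  Finset.prod_pos fun _ _ => one_sub_pow_pos h0 h1 (by omega)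

theorem one_sub_mul_oddProd_mul_qPi (q : ℝ) (m : ℕ) :
    (1 - q) * oddProd q m * qPi m (q ^ 2) = qPi (2 * m + 1) q := by
  induction m with
  | zero => simp [oddProd, qPi]
  | succ m ih =>
    rw [oddProd, Finset.prod_range_succ, ← oddProd, show 2 * (m + 1) + 1 = 2 * m + 1 + 1 + 1 by ring,
      qPi_succ (2 * m + 1 + 1), qPi_succ (2 * m + 1), ← ih, qPi_succ]
    ring

theorem tendsto_oddProd (h0 : 0 ≤ q) (h1 : q < 1) :
    Tendsto (oddProd q) atTop (𝓝 (qPiInf q / ((1 - q) * qPiInf (q ^ 2)))) := by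
  have hx := sq_lt_one_of_lt_one h0 h1
  have hq : 1 - q ≠ 0 := by linarith
  have h := ((tendsto_qPi h0 h1).comp (tendsto_add_atTop_nat 1 |>.comp
    (tendsto_id.const_mul_atTop' (show 0 < 2 by norm_num)))).div
    ((tendsto_qPi (sq_nonneg q) hx).const_mul (1 - q))
    (mul_ne_zero hq (qPiInf_ne_zero (sq_nonneg q) hx))
  refine h.congr fun m => ?_
  have := (qPi_pos (sq_nonneg q) hx m).ne'
  simp only [Pi.div_apply, Function.comp_apply, id]
  rw [← one_sub_mul_oddProd_mul_qPi]
  field_simp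

theorem oddCoeff_zero_right (q : ℝ) (m : ℕ) : oddCoeff q m 0 = 1 := by simp [oddCoeff, qPi_zero]

theorem oddCoeff_zero_left (q : ℝ) (j : ℕ) : oddCoeff q 0 (j + 1) = 0 := by
  simp [oddCoeff, Finset.prod_range_succ']

theorem oddCoeff_nonneg (h0 : 0 ≤ q) (h1 : q < 1) (m j : ℕ) : 0 ≤ oddCoeff q m j := by
  have hx := sq_lt_one_of_lt_one h0 h1
  exact div_nonneg (mul_nonneg (pow_nonneg h0 _)
    (Finset.prod_nonneg fun i _ => one_sub_pow_nonneg (sq_nonneg q) hx _))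
    (qPi_pos (sq_nonneg q) hx j).le

/-- A Pascal rule: passing from m to m + 1 multiplies the generating function by 1 / (1 - q^(2m+3)
t²). -/
theorem oddCoeff_succ_succ (h0 : 0 ≤ q) (h1 : q < 1) (m j : ℕ) :
    oddCoeff q (m + 1) (j + 1) =
      oddCoeff q m (j + 1) + q ^ (2 * m + 3) * oddCoeff q (m + 1) j := by
  have hx := sq_lt_one_of_lt_one h0 h1
  have h2 := (qPi_pos (sq_nonneg q) hx j).ne'
  have h3 := (one_sub_pow_pos (sq_nonneg q) hx j.succ_ne_zero).ne'
  have h4 : ∏ i ∈ Finset.range (j + 1), (1 - (q ^ 2) ^ (m + i)) =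
      (∏ i ∈ Finset.range j, (1 - (q ^ 2) ^ (m + 1 + i))) * (1 - (q ^ 2) ^ m) := by
    rw [Finset.prod_range_succ', add_zero]
    congr 1
    exact Finset.prod_congr rfl fun i _ => by rw [add_right_comm, add_assoc]
  rw [oddCoeff, oddCoeff, oddCoeff, h4, Finset.prod_range_succ, qPi_succ]
  field_simp
  ring

theorem tendsto_oddCoeff (h0 : 0 ≤ q) (h1 : q < 1) (j : ℕ) :
    Tendsto (fun m => oddCoeff q m j) atTop (𝓝 (q ^ (3 * j) / qPi j (q ^ 2))) := by
  have hx := sq_lt_one_of_lt_one h0 h1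
  refine Tendsto.div_const ?_ _
  have h : Tendsto (fun m => ∏ i ∈ Finset.range j, (1 - (q ^ 2) ^ (m + i))) atTop
      (𝓝 (∏ i ∈ Finset.range j, (1 - 0))) :=
    tendsto_finsetProd _ fun i _ => tendsto_const_nhds.sub
      ((tendsto_pow_atTop_nhds_zero_of_lt_one (sq_nonneg q) hx).comp (tendsto_add_atTop_nat i))
  simpa using h.const_mul (q ^ (3 * j))

theorem oddProb_zero_right (q : ℝ) (N m : ℕ) : oddProb q N m 0 = 0 := by simp [oddProb]

theorem oddProb_zero_left (q : ℝ) {N k : ℕ} (hk : k ≤ 2 * N) : oddProb q N 0 k = 1 - q ^ k := by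
  rcases N with _ | N
  · obtain rfl : k = 0 := by omega
    simp [oddProb]
  · simp [oddProb, oddProd, Finset.sum_range_succ', oddCoeff_zero_left, oddCoeff_zero_right]

theorem oddProb_succ (h0 : 0 ≤ q) (h1 : q < 1) {N k : ℕ} (hk : k ≤ 2 * N) (m : ℕ) :
    oddProb q N (m + 1) k =
      (1 - q ^ (2 * m + 3)) * oddProb q N m k + q ^ (2 * m + 3) * oddProb q N (m + 1) (k - 2) := by
  rcases N with _ | N
  · simp [oddProb]
  have hC : oddProd q (m + 1) = oddProd q m * (1 - q ^ (2 * m + 3)) := Finset.prod_range_succ _ _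
  have hS : ∑ j ∈ Finset.range (N + 1), oddCoeff q (m + 1) j * (1 - q ^ (k - 2 * j)) =
      ∑ j ∈ Finset.range (N + 1), oddCoeff q m j * (1 - q ^ (k - 2 * j)) +
      q ^ (2 * m + 3) *
        ∑ j ∈ Finset.range (N + 1), oddCoeff q (m + 1) j * (1 - q ^ (k - 2 - 2 * j)) := by
    -- The index shift leaves over the term j = N of the last sum, which is zero because k - 2 - 2N
    -- = 0.
    rw [Finset.sum_range_succ', Finset.sum_range_succ' _ N,
      Finset.sum_range_succ (fun j => oddCoeff q (m + 1) j * (1 - q ^ (k - 2 - 2 * j))) N,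
      show k - 2 - 2 * N = 0 by omega, pow_zero, sub_self, mul_zero (oddCoeff _ _ N), add_zero, Finset.mul_sum,
      add_right_comm, ← Finset.sum_add_distrib, oddCoeff_zero_right, oddCoeff_zero_right]
    congr 1
    refine Finset.sum_congr rfl fun j _ => ?_
    rw [oddCoeff_succ_succ h0 h1, Nat.sub_sub, show 2 + 2 * j = 2 * (j + 1) by ring]
    ring
  rw [oddProb, hS, oddProb, oddProb, hC]
  ring

theorem oddProb_mono (h0 : 0 ≤ q) (h1 : q < 1) (N m : ℕ) : Monotone (oddProb q N m) := by
  intro k l h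
  refine mul_le_mul_of_nonneg_left (Finset.sum_le_sum fun j _ =>
    mul_le_mul_of_nonneg_left (sub_le_sub_left ?_ _) (oddCoeff_nonneg h0 h1 m j))
    (oddProd_pos h0 h1 m).le
  exact pow_le_pow_of_le_one h0 h1.le (by omega)

/-- The value decreases in m: replacing k - 2 by k in `oddProb_succ` only increases the right side.
At m = 0 equality holds. -/
theorem oddProb_le (h0 : 0 ≤ q) (h1 : q < 1) {N k : ℕ} (hk : k ≤ 2 * N) (m : ℕ) :
    oddProb q N m k ≤ 1 - q ^ k := by
  induction m with
  | zero => exact (oddProb_zero_left q hk).le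
  | succ m ih =>
    refine le_trans ?_ ih
    have ha := one_sub_pow_pos h0 h1 (n := 2 * m + 3) (by omega)
    have hm := mul_le_mul_of_nonneg_left (oddProb_mono h0 h1 N (m + 1) (Nat.sub_le k 2))
      (pow_nonneg h0 (2 * m + 3))
    have := oddProb_succ h0 h1 hk m
    refine le_of_mul_le_mul_left ?_ ha
    linarith

theorem tendsto_oddProb (h0 : 0 ≤ q) (h1 : q < 1) (N k : ℕ) :
    Tendsto (fun m => oddProb q N m k) atTop
      (𝓝 (qPiInf q / ((1 - q) * qPiInf (q ^ 2)) *
        ∑ j ∈ Finset.range N, q ^ (3 * j) / qPi j (q ^ 2) * (1 - q ^ (k - 2 * j)))) :=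
  (tendsto_oddProd h0 h1).mul (tendsto_finsetSum _ fun j _ =>
    (tendsto_oddCoeff h0 h1 j).mul_const _)

/-- The solution of the recursion for the probabilities `G n k` that `p ^ k` does not divide the
determinant of a random symmetric `n × n` matrix. -/
theorem eq_oddProb_of_recursion (h0 : 0 ≤ q) (h1 : q < 1) {G : ℕ → ℕ → ℝ} {M N : ℕ}
    (hMN : M ≤ 2 * N) (hG0 : ∀ n, G n 0 = 0) (hG1 : ∀ k, 1 ≤ k → k ≤ M → G 0 k = 1)
    (hG : ∀ n k, k ≤ M → G (n + 1) k = (1 - q) * G n k + q * (1 - q ^ n) * G (n - 1) k +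
      q ^ (n + 1) * ((1 - q) * G n (k - 1) + q * G (n + 1) (k - 2))) (m : ℕ) :
    (∀ k ≤ M, (1 - q ^ (2 * m + 1)) * G (2 * m) k =
      oddProb q N m k - q ^ (2 * m + 1) * oddProb q N m (k - 1)) ∧
    ∀ k ≤ M, G (2 * m + 1) k = oddProb q N m k := by
  induction m with
  | zero =>
    constructor
    · intro k hk
      rcases k with _ | k
      · simp [hG0, oddProb_zero_right]
      · rw [oddProb_zero_left q (by omega), oddProb_zero_left q (by omega), mul_zero,
          hG1 _ (by omega) hk, Nat.add_sub_cancel]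
        ring
    · intro k
      -- The recursion relates k to k - 2 in the same size, hence an inner induction on k.
      induction k using Nat.strong_induction_on with
      | _ k ih =>
        intro hk
        rcases k with _ | _ | k
        · simp [hG0, oddProb_zero_right]
        · rw [oddProb_zero_left q (by omega), hG _ _ hk]
          simp [hG0, hG1 1 le_rfl hk]
        · have := ih k (by omega) (by omega)
          rw [oddProb_zero_left q (by omega)] at this ⊢
          rw [hG _ _ hk]
          simp only [mul_zero, zero_add, Nat.add_sub_cancel, Nat.reduceSubDiff] at this ⊢
          rw [this, hG1 _ (by omega) hk, hG1 _ (by omega) (by omega)]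
          ring
  | succ m ih =>
    obtain ⟨ihe, iho⟩ := ih
    have ha := (one_sub_pow_pos h0 h1 (n := 2 * m + 3) (by omega)).ne'
    have hR : ∀ k ≤ M, _ := fun k hk => oddProb_succ h0 h1 (hk.trans hMN) m
    have even : ∀ k ≤ M, (1 - q ^ (2 * m + 3)) * G (2 * m + 2) k =
        oddProb q N (m + 1) k - q ^ (2 * m + 3) * oddProb q N (m + 1) (k - 1) := by
      intro k
      induction k using Nat.strong_induction_on with
      | _ k ih =>
        intro hk
        rcases Nat.eq_zero_or_pos k with rfl | hk0
        · simp [hG0, oddProb_zero_right]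
        have i2 := ih (k - 2) (by omega) (by omega)
        have e := hG (2 * m + 1) k hk
        have r1 := hR k hk
        have r2 := hR (k - 1) (by omega)
        -- The coefficient of `G (2 * m) k` in the recursion contains exactly the factor 1 -
        -- q^(2m+1) of the even formula, so no division is needed here.
        have e1 := ihe k hk
        rw [Nat.add_sub_cancel, iho k hk, iho (k - 1) (by omega)] at e
        rw [show k - 2 - 1 = k - 1 - 2 by omega] at i2
        rw [show 2 * m + 1 + 1 = 2 * m + 2 by ring] at e
        linear_combination (1 - q ^ (2 * m + 3)) * e + (1 - q ^ (2 * m + 3)) * q * e1 +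
          q ^ (2 * m + 3) * i2 - r1 + q ^ (2 * m + 3) * r2
    refine ⟨even, fun k => ?_⟩
    induction k using Nat.strong_induction_on with
    | _ k ih =>
      intro hk
      rcases Nat.eq_zero_or_pos k with rfl | hk0
      · simp [hG0, oddProb_zero_right]
      have i2 := ih (k - 2) (by omega) (by omega)
      have e := hG (2 * m + 2) k hk
      have r1 := hR k hk
      have e1 := even k hk
      have e2 := even (k - 1) (by omega)
      rw [show 2 * m + 2 - 1 = 2 * m + 1 by omega, iho k hk] at e
      rw [show k - 1 - 1 = k - 2 by omega] at e2
      rw [show 2 * (m + 1) + 1 = 2 * m + 2 + 1 by ring] at i2 ⊢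
      rw [i2] at e
      refine mul_left_cancel₀ ha ?_
      linear_combination (1 - q ^ (2 * m + 3)) * e + (1 - q) * e1 +
        q ^ (2 * m + 3) * (1 - q) * e2 - q * (1 - q ^ (2 * m + 2)) * r1

end ClosedForm

/-! ### Passage to the limit and the final identities. -/

open SymMat in
theorem tendsto_symP {p : ℕ} (hp : p.Prime) {M N : ℕ} (hM : 1 ≤ M) (hN : M ≤ 2 * N) {q : ℝ}
    (hq : q = 1 / p) (h0 : 0 ≤ q) (h1 : q < 1) {L : ℝ}
    (hL : Tendsto (fun m => oddProb q N m M) atTop (𝓝 L)) :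
    Tendsto (fun n => symP n (p ^ M)) atTop (𝓝 L) := by
  have : NeZero (p ^ M) := ⟨pow_ne_zero M hp.ne_zero⟩
  have key (m : ℕ) := eq_oddProb_of_recursion h0 h1 hN (G := probNotDvd p M)
    probNotDvd_zero_right (fun k => probNotDvd_zero_left hp)
    (fun n k hk => probNotDvd_succ hp hM hq n hk) m
  simp_rw [symP_eq_probNotDvd hp hM]
  refine tendsto_atTop_of_even_odd ?_ (hL.congr fun m => ((key m).2 M le_rfl).symm)
  -- In even sizes the formula differs from the odd one by terms with factor q^(2m+1), which
  -- disappear in the limit.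
  have ha : Tendsto (fun m : ℕ => q ^ (2 * m + 1)) atTop (𝓝 0) :=
    (tendsto_pow_atTop_nhds_zero_of_lt_one h0 h1).comp
      (tendsto_atTop_mono (fun m => show m ≤ 2 * m + 1 by omega) tendsto_id)
  have h := (hL.sub (ha.mul (tendsto_oddProb h0 h1 N (M - 1)))).div
    (tendsto_const_nhds (x := (1 : ℝ)) |>.sub ha) (by norm_num)
  rw [zero_mul, sub_zero, sub_zero, div_one] at h
  refine h.congr fun m => ?_
  have := (one_sub_pow_pos h0 h1 (n := 2 * m + 1) (by omega)).ne'
  simp only [Pi.div_apply]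
  rw [← (key m).1 M le_rfl]
  field_simp

/-- This is Euler's expansion at x = q², z = q³, whose partial products are `oddProd q n`. -/
theorem mul_tsum_cube_pow_div_qPi {q : ℝ} (h0 : 0 ≤ q) (h1 : q < 1) :
    qPiInf q / ((1 - q) * qPiInf (q ^ 2)) * ∑' j : ℕ, (q ^ 3) ^ j / qPi j (q ^ 2) = 1 := by
  refine tendsto_nhds_unique ((tendsto_oddProd h0 h1).mul_const _) ?_
  refine (tendsto_prod_mul_tsum_pow_div_qPi (sq_nonneg q) (sq_lt_one_of_lt_one h0 h1)
    (pow_nonneg h0 3) (pow_lt_one₀ h0 h1 three_ne_zero)).congr fun n => ?_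
  congr 1
  exact Finset.prod_congr rfl fun i _ => by ring

theorem corollary5p1 (p : ℕ) (hp : p.Prime) (μ : ℕ) (hμ : 1 ≤ μ)
    (q : ℝ) (hq : q = 1 / (p : ℝ)) (s : ℕ) (hs : s = (μ - 1) / 2) :
    (∃ L ∈ Set.Icc (q ^ μ) (q ^ μ / (1 - q)),
      Tendsto (fun n : ℕ => symQ n (p ^ μ)) atTop (𝓝 L)) ∧
    Tendsto (fun n : ℕ => symP n (p ^ μ)) atTop
      (𝓝 (qPiInf q / ((1 - q) * qPiInf (q ^ 2)) *
        ∑ j ∈ Finset.range (s + 1), (q ^ (3 * j) - q ^ (μ + j)) / qPi j (q ^ 2))) ∧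
    (Summable fun i : ℕ =>
      (q ^ (μ + (s + 1 + i)) - q ^ (3 * (s + 1 + i))) / qPi (s + 1 + i) (q ^ 2)) ∧
    Tendsto (fun n : ℕ => symQ n (p ^ μ)) atTop
      (𝓝 ((q ^ μ - qPiInf q / qPiInf (q ^ 2) *
        ∑' i : ℕ, (q ^ (μ + (s + 1 + i)) - q ^ (3 * (s + 1 + i))) / qPi (s + 1 + i) (q ^ 2)) /
          (1 - q))) := by
  have hp1 : (1 : ℝ) < p := by exact_mod_cast hp.one_lt
  have h0 : 0 ≤ q := by rw [hq]; positivity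
  have h1 : q < 1 := by rw [hq, div_lt_one (by linarith)]; exact hp1
  have hx0 := sq_nonneg q
  have hx1 := sq_lt_one_of_lt_one h0 h1
  have hq1 : 0 < 1 - q := sub_pos.2 h1
  have hμs : μ ≤ 2 * (s + 1) := by omega
  have hodd : Tendsto (fun m => oddProb q (s + 1) m μ) atTop
      (𝓝 (qPiInf q / ((1 - q) * qPiInf (q ^ 2)) *
        ∑ j ∈ Finset.range (s + 1), (q ^ (3 * j) - q ^ (μ + j)) / qPi j (q ^ 2))) := by
    convert tendsto_oddProb h0 h1 (s + 1) μ using 3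
    refine Finset.sum_congr rfl fun j hj => ?_
    have hj := Finset.mem_range.1 hj
    -- The subtraction is genuine, since j ≤ s gives 2j < μ.
    rw [show μ + j = 3 * j + (μ - 2 * j) by omega, pow_add]
    ring
  have hP := tendsto_symP hp hμ hμs hq h0 h1 hodd
  have hs1 := summable_pow_div_qPi hx0 hx1 h0 h1
  have hs3 := summable_pow_div_qPi hx0 hx1 (pow_nonneg h0 3) (pow_lt_one₀ h0 h1 three_ne_zero)
  have hterm (j : ℕ) : (q ^ (μ + j) - q ^ (3 * j)) / qPi j (q ^ 2) =
      q ^ μ * (q ^ j / qPi j (q ^ 2)) - (q ^ 3) ^ j / qPi j (q ^ 2) := by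
    rw [pow_add, pow_mul]
    ring
  have hsum : Summable fun j : ℕ => (q ^ (μ + j) - q ^ (3 * j)) / qPi j (q ^ 2) := by
    simp_rw [hterm]
    exact (hs1.mul_left _).sub hs3
  have htail := (summable_nat_add_iff (s + 1)).2 hsum
  have hsplit := hsum.sum_add_tsum_nat_add (s + 1)
  rw [tsum_congr hterm, (hs1.mul_left _).tsum_sub hs3, tsum_mul_left] at hsplit
  simp_rw [add_comm _ (s + 1)] at htail hsplit
  have hneg : ∑ j ∈ Finset.range (s + 1), (q ^ (μ + j) - q ^ (3 * j)) / qPi j (q ^ 2) =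
      -∑ j ∈ Finset.range (s + 1), (q ^ (3 * j) - q ^ (μ + j)) / qPi j (q ^ 2) := by
    rw [← Finset.sum_neg_distrib]
    exact Finset.sum_congr rfl fun j _ => by ring
  -- For x = q² and z = q one has xz = q³, so the functional equation links the two series in
  -- `hsplit`.
  have hE := one_sub_mul_tsum_pow_div_qPi hx0 hx1 h0 h1
  rw [← pow_succ] at hE
  have hK := mul_tsum_cube_pow_div_qPi h0 h1
  rw [mul_comm (1 - q) (qPiInf _), ← div_div] at hK hP hodd ⊢
  have hnonneg : 0 ≤ ∑' i : ℕ,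
      (q ^ (μ + (s + 1 + i)) - q ^ (3 * (s + 1 + i))) / qPi (s + 1 + i) (q ^ 2) :=
    -- For j ≥ s + 1 one has 2j ≥ μ, hence q^(3j) ≤ q^(μ+j).
    tsum_nonneg fun i => div_nonneg
      (sub_nonneg.2 (pow_le_pow_of_le_one h0 h1.le (by omega))) (qPi_pos hx0 hx1 _).le
  have hK0 : 0 ≤ qPiInf q / qPiInf (q ^ 2) :=
    div_nonneg (qPiInf_pos h0 h1).le (qPiInf_pos hx0 hx1).le
  rw [hneg] at hsplit
  generalize ∑' i : ℕ, (q ^ (μ + (s + 1 + i)) - q ^ (3 * (s + 1 + i))) / qPi (s + 1 + i) (q ^ 2) = T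
    at *
  generalize ∑ j ∈ Finset.range (s + 1), (q ^ (3 * j) - q ^ (μ + j)) / qPi j (q ^ 2) = S at *
  generalize qPiInf q / qPiInf (q ^ 2) = K at *
  generalize ∑' j : ℕ, (q ^ 3) ^ j / qPi j (q ^ 2) = E₃ at *
  generalize ∑' j : ℕ, q ^ j / qPi j (q ^ 2) = E₁ at *
  have heq : 1 - K / (1 - q) * S = (q ^ μ - K * T) / (1 - q) := by
    have hKE₃ : K * E₃ = 1 - q := by field_simp at hK; linarith
    have hKE₁ : K * E₁ = 1 :=
      mul_left_cancel₀ hq1.ne' (by linear_combination K * hE + hKE₃)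
    field_simp
    linear_combination K * hsplit + q ^ μ * hKE₁ - hKE₃
  have hQ : Tendsto (fun n => symQ n (p ^ μ)) atTop (𝓝 ((q ^ μ - K * T) / (1 - q))) := by
    rw [← heq]
    exact hP.const_sub 1
  refine ⟨⟨_, ⟨?_, ?_⟩, hQ⟩, hP, htail, hQ⟩
  · rw [← heq]
    have := le_of_tendsto' hodd (oddProb_le h0 h1 hμs)
    linarith
  · exact div_le_div_of_nonneg_right (sub_le_self _ (mul_nonneg hK0 hnonneg)) hq1.le
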